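/- Let $n\ge 1$ and let $B$ be a Hermitian $n\times n$ complex matrix with eigenvalues $b_1\le b_2\le\dots\le b_n$ (counted with multiplicity). Let $h$ be a real function that is concave on $[b_1,b_n]$ and differentiable at every $b_j$ as a function on $[b_1,b_n]$ (so that $h'(b_1)$ and $h'(b_n)$ denote the one-sided derivatives), with $h'(b_1)=0$ and $h'(b_n)=-1$. Let $K$ be the Loewner matrix of $h$ at $B$, that is $$ K_{ij}=\begin{cases}\dfrac{h(b_i)-h(b_j)}{b_i-b_j}, & b_i\ne b_j,\\[2mm] h'(b_i), & b_i=b_j.\end{cases} $$ Let $S_K: A\mapsto K\circ A$ be the entrywise (Schur) multiplication by $K$ on complex $n\times n$ matrices, and let $\|S_K\|=\sup_{A\ne 0}\|K\circ A\|/\|A\|$, where $\|\cdot\|$ is the operator (spectral) norm. Then $$ \|S_K\|\le 1+\phi^{-1}\sum_{j=1}^{n}\bigl(1+h'(b_j)\bigr), $$ where $\phi=(1+\sqrt5)/2$ is the golden ratio. -/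

import Mathlib

open scoped Matrix Matrix.Norms.L2Operator

/-- The points `b i`, listed over `Fin n`, are the eigenvalues of the complex matrix `B`,
each repeated according to its (algebraic) multiplicity. -/
def IsEigenvalueList {n : ℕ} (B : Matrix (Fin n) (Fin n) ℂ) (b : Fin n → ℝ) : Prop :=
  B.charpoly.roots = Finset.univ.val.map (fun i => (b i : ℂ))

/-- The Loewner matrix, at the points `b i`, of a function `f` considered on the set `S`.
The derivative is taken within `S`, hence is one-sided at an end point of an interval `S`. -/
noncomputable def loewnerMatrix {n : ℕ} (f : ℝ → ℝ) (S : Set ℝ) (b : Fin n → ℝ) :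
    Matrix (Fin n) (Fin n) ℂ :=
  Matrix.of fun i j =>
    ((if b i = b j then derivWithin f S (b i)
      else (f (b i) - f (b j)) / (b i - b j) : ℝ) : ℂ)

/-- The Schur multiplier operator `A ↦ L ∘ A` (entrywise product). -/
def schurMultiplier {n : ℕ} (L : Matrix (Fin n) (Fin n) ℂ) :
    Matrix (Fin n) (Fin n) ℂ →ₗ[ℂ] Matrix (Fin n) (Fin n) ℂ where
  toFun A := L ⊙ A
  map_add' A A' := Matrix.hadamard_add L A A'
  map_smul' c A := Matrix.hadamard_smul L A c

/-- The Schur multiplier norm: the norm of `A ↦ L ∘ A` induced by the operator (spectral) norm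
on complex `n × n` matrices, that is `sup_A ‖L ∘ A‖ / ‖A‖`. -/
noncomputable def schurNorm {n : ℕ} (L : Matrix (Fin n) (Fin n) ℂ) : ℝ :=
  ⨆ A : Matrix (Fin n) (Fin n) ℂ, ‖schurMultiplier L A‖ / ‖A‖

/-- The supremum defining `schurNorm` is a genuine one: the ratios are bounded. -/
theorem schurNorm_bddAbove {n : ℕ} (L : Matrix (Fin n) (Fin n) ℂ) :
    BddAbove (Set.range fun A : Matrix (Fin n) (Fin n) ℂ => ‖schurMultiplier L A‖ / ‖A‖) := by
  refine ⟨‖LinearMap.toContinuousLinearMap (schurMultiplier L)‖, ?_⟩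
  rintro _ ⟨A, rfl⟩
  exact (LinearMap.toContinuousLinearMap (schurMultiplier L)).ratio_le_opNorm A

/-! The convex function `-h` has slopes increasing from 0 to 1 along the spectrum. Its values and
slopes at the eigenvalues are matched by a piecewise linear function with one kink per gap
(`exists_kink`). So `-K` is a convex combination of Loewner matrices of positive parts `(· - t k)⁺`,
weighted by the slope jumps. Each of these is 0 on the block of the first `k + 1` indices, 1 on the
complementary block and in `[0, 1]` elsewhere, so `norm_hadamard_le_of_blocks` bounds its multiplier
norm by `1 + φ⁻¹ (k + 1)`. Averaging and summing by parts gives the constant. -/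

/-! ### Schur multipliers with two constant blocks -/

theorem sum_norm_sq_mulVec_le {m : Type*} [Fintype m] [DecidableEq m] (A : Matrix m m ℂ)
    (u : m → ℂ) : ∑ i, ‖(A *ᵥ u) i‖ ^ 2 ≤ ‖A‖ ^ 2 * ∑ j, ‖u j‖ ^ 2 := by
  have h := Matrix.l2_opNorm_mulVec A (WithLp.toLp 2 u)
  have h2 := pow_le_pow_left₀ (norm_nonneg _) h 2
  rw [mul_pow, EuclideanSpace.norm_sq_eq, EuclideanSpace.norm_sq_eq] at h2
  simpa using h2

theorem l2_opNorm_le_of_sum_norm_sq_le {m : Type*} [Fintype m] [DecidableEq m] (A : Matrix m m ℂ)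
    {c : ℝ} (hc : 0 ≤ c)
    (h : ∀ u : m → ℂ, ∑ i, ‖(A *ᵥ u) i‖ ^ 2 ≤ c ^ 2 * ∑ j, ‖u j‖ ^ 2) : ‖A‖ ≤ c := by
  rw [Matrix.cstar_norm_def]
  refine ContinuousLinearMap.opNorm_le_bound _ hc fun x => ?_
  refine le_of_sq_le_sq ?_ (by positivity)
  rw [mul_pow, EuclideanSpace.norm_sq_eq, EuclideanSpace.norm_sq_eq]
  simpa [Matrix.ofLp_toEuclideanCLM] using h x.ofLp

theorem sum_norm_sq_col_le {m : Type*} [Fintype m] [DecidableEq m] (A : Matrix m m ℂ) (j : m) :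
    ∑ i, ‖A i j‖ ^ 2 ≤ ‖A‖ ^ 2 := by
  have h := sum_norm_sq_mulVec_le A (Pi.single j 1)
  have hs : ∑ x, ‖(Pi.single j (1 : ℂ) : m → ℂ) x‖ ^ 2 = 1 := by
    rw [Finset.sum_eq_single j] <;> simp +contextual
  rw [hs] at h
  simpa using h

/-- Young's inequality with the conjugate weights `r` and `r / (r - 1)`, cleared of denominators. -/
theorem sub_one_mul_norm_add_sq_le {E : Type*} [SeminormedAddCommGroup E] {r : ℝ} (hr : 1 < r)
    (x y : E) : (r - 1) * ‖x + y‖ ^ 2 ≤ (r - 1) * r * ‖x‖ ^ 2 + r * ‖y‖ ^ 2 := by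
  have h := pow_le_pow_left₀ (norm_nonneg _) (norm_add_le x y) 2
  have h2 := mul_le_mul_of_nonneg_left h (sub_nonneg.2 hr.le)
  nlinarith [sq_nonneg ((r - 1) * ‖x‖ - ‖y‖)]

/-- A Schur multiplier that vanishes on one diagonal block, is constantly `1` on the other one, and
is bounded by `1` off the diagonal blocks. -/
theorem norm_hadamard_le_of_blocks {m : Type*} [Fintype m] [DecidableEq m] (L A : Matrix m m ℂ)
    (s : Finset m) {r : ℝ} (hr : 1 < r) (hs : (s.card : ℝ) ≤ r * (r - 1))
    (h0 : ∀ i ∈ s, ∀ j ∈ s, L i j = 0) (h1 : ∀ i ∉ s, ∀ j ∉ s, L i j = 1)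
    (hL : ∀ i j, ‖L i j‖ ≤ 1) : ‖L ⊙ A‖ ≤ r * ‖A‖ := by
  refine l2_opNorm_le_of_sum_norm_sq_le _ (by positivity) fun u => ?_
  set a := ‖A‖
  set U1 := ∑ j ∈ s, ‖u j‖ ^ 2
  set U2 := ∑ j ∈ sᶜ, ‖u j‖ ^ 2
  have hU1 : 0 ≤ U1 := Finset.sum_nonneg fun _ _ => by positivity
  have hU2 : 0 ≤ U2 := Finset.sum_nonneg fun _ _ => by positivity
  have hU : ∑ j, ‖u j‖ ^ 2 = U1 + U2 := (Finset.sum_add_sum_compl s _).symm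
  have hrest : ∀ v : m → ℂ, (∀ j ∈ s, v j = 0) → (∀ j ∉ s, ‖v j‖ ≤ ‖u j‖) →
      ∑ i, ‖(A *ᵥ v) i‖ ^ 2 ≤ a ^ 2 * U2 := by
    intro v hv0 hv
    refine (sum_norm_sq_mulVec_le A v).trans ?_
    refine mul_le_mul_of_nonneg_left ?_ (by positivity)
    rw [← Finset.sum_add_sum_compl s, Finset.sum_eq_zero fun j hj => by simp [hv0 j hj], zero_add]
    refine Finset.sum_le_sum fun j hj => pow_le_pow_left₀ (norm_nonneg _) (hv j ?_) 2
    simpa using hj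
  -- Row `i` of `L` is absorbed into the vector. That vector depends on `i`, so summing over rows
  -- costs a factor `s.card`.
  have htop : ∀ i ∈ s, ‖((L ⊙ A) *ᵥ u) i‖ ^ 2 ≤ a ^ 2 * U2 := by
    intro i hi
    have h := hrest (fun j => L i j * u j) (fun j hj => by simp [h0 i hi j hj]) fun j _ => by
      simpa using mul_le_mul_of_nonneg_right (hL i j) (norm_nonneg (u j))
    refine le_trans (le_of_eq_of_le ?_ (Finset.single_le_sum
      (f := fun i' => ‖(A *ᵥ fun j => L i j * u j) i'‖ ^ 2) (fun _ _ => by positivity)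
      (Finset.mem_univ i))) h
    congr 2
    exact Finset.sum_congr rfl fun j _ => by simp only [Matrix.hadamard_apply]; ring
  set x : m → ℂ := A *ᵥ fun j => if j ∈ s then 0 else u j
  set y : m → ℂ := fun i => ∑ j ∈ s, L i j * A i j * u j
  have hx : ∑ i, ‖x i‖ ^ 2 ≤ a ^ 2 * U2 :=
    hrest _ (fun j hj => by simp [hj]) fun j hj => by simp [hj]
  have hy : ∑ i, ‖y i‖ ^ 2 ≤ a ^ 2 * (s.card * U1) := by
    calc ∑ i, ‖y i‖ ^ 2 ≤ ∑ i, (∑ j ∈ s, ‖A i j‖ ^ 2) * U1 := by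
          refine Finset.sum_le_sum fun i _ => ?_
          refine le_trans (pow_le_pow_left₀ (norm_nonneg _) (norm_sum_le_of_le s
            (f := fun j => L i j * A i j * u j) (n := fun j => ‖A i j‖ * ‖u j‖) fun j _ => ?_) 2)
            (Finset.sum_mul_sq_le_sq_mul_sq s _ _)
          rw [norm_mul, norm_mul]
          exact mul_le_mul_of_nonneg_right (mul_le_of_le_one_left (norm_nonneg _) (hL i j))
            (norm_nonneg _)
      _ = (∑ j ∈ s, ∑ i, ‖A i j‖ ^ 2) * U1 := by rw [← Finset.sum_mul, Finset.sum_comm]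
      _ ≤ (∑ j ∈ s, a ^ 2) * U1 :=
          mul_le_mul_of_nonneg_right (Finset.sum_le_sum fun j _ => sum_norm_sq_col_le A j) hU1
      _ = a ^ 2 * (s.card * U1) := by rw [Finset.sum_const, nsmul_eq_mul]; ring
  have hsplit : ∀ i ∈ sᶜ, ((L ⊙ A) *ᵥ u) i = x i + y i := by
    intro i hi
    have hi' : i ∉ s := by simpa using hi
    change ∑ j, L i j * A i j * u j = ∑ j, A i j * (if j ∈ s then 0 else u j) + _
    rw [← Finset.sum_add_sum_compl s, add_comm]
    congr 1
    rw [← Finset.sum_add_sum_compl s, Finset.sum_eq_zero (s := s) fun j hj => by simp [hj],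
      zero_add]
    refine Finset.sum_congr rfl fun j hj => ?_
    have hj' : j ∉ s := by simpa using hj
    simp [hj', h1 i hi' j hj']
  have hS1 : ∑ i ∈ s, ‖((L ⊙ A) *ᵥ u) i‖ ^ 2 ≤ s.card * (a ^ 2 * U2) := by
    simpa using Finset.sum_le_card_nsmul s _ _ htop
  have hS2 : (r - 1) * ∑ i ∈ sᶜ, ‖((L ⊙ A) *ᵥ u) i‖ ^ 2 ≤
      (r - 1) * r * (a ^ 2 * U2) + r * (a ^ 2 * (s.card * U1)) := by
    calc (r - 1) * ∑ i ∈ sᶜ, ‖((L ⊙ A) *ᵥ u) i‖ ^ 2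
        ≤ ∑ i ∈ sᶜ, ((r - 1) * r * ‖x i‖ ^ 2 + r * ‖y i‖ ^ 2) := by
          rw [Finset.mul_sum]
          refine Finset.sum_le_sum fun i hi => ?_
          rw [hsplit i hi]
          exact sub_one_mul_norm_add_sq_le hr _ _
      _ ≤ ∑ i, ((r - 1) * r * ‖x i‖ ^ 2 + r * ‖y i‖ ^ 2) :=
          Finset.sum_le_sum_of_subset_of_nonneg (Finset.subset_univ _) fun i _ _ => by
            have := sub_pos.2 hr
            positivity
      _ = (r - 1) * r * ∑ i, ‖x i‖ ^ 2 + r * ∑ i, ‖y i‖ ^ 2 := by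
          rw [Finset.sum_add_distrib, ← Finset.mul_sum, ← Finset.mul_sum]
      _ ≤ _ := by
          have := sub_pos.2 hr
          gcongr
  -- With `s.card ≤ r * (r - 1)`, `U2` gets the coefficient `r * (r - 1) + r = r ^ 2` and `U1` gets
  -- `r / (r - 1) * s.card ≤ r ^ 2`, up to `a ^ 2`.
  have hr1 := sub_pos.2 hr
  have hS1' := mul_le_mul_of_nonneg_left hS1 hr1.le
  have e1 : (s.card : ℝ) * (a ^ 2 * U2) ≤ r * (r - 1) * (a ^ 2 * U2) :=
    mul_le_mul_of_nonneg_right hs (by positivity)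
  have e2 : (s.card : ℝ) * (a ^ 2 * U1) ≤ r * (r - 1) * (a ^ 2 * U1) :=
    mul_le_mul_of_nonneg_right hs (by positivity)
  have e3 := mul_le_mul_of_nonneg_left e1 hr1.le
  have e4 := mul_le_mul_of_nonneg_left e2 (zero_lt_one.trans hr).le
  rw [hU, ← Finset.sum_add_sum_compl s]
  refine le_of_mul_le_mul_left ?_ hr1
  linarith

/-! ### Decomposition into kinks -/

/-- Every value between `p * (y - x)` and `q * (y - x)` is the increment over `[x, y]` of a
continuous function with slope `p` before some point and slope `q` after it. -/
theorem exists_kink {x y p q v : ℝ} (hxy : x ≤ y) (h1 : p * (y - x) ≤ v) (h2 : v ≤ q * (y - x))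
    (hpq : p ≤ q) : ∃ t, x ≤ t ∧ t ≤ y ∧ v = p * (t - x) + q * (y - t) := by
  rcases hpq.eq_or_lt with rfl | hlt
  · exact ⟨x, le_rfl, hxy, by linarith⟩
  · have h := sub_pos.2 hlt
    refine ⟨y - (v - p * (y - x)) / (q - p), ?_, ?_, ?_⟩
    · rw [le_sub_comm, div_le_iff₀ h]
      linarith
    · rw [sub_le_self_iff]
      exact div_nonneg (by linarith) h.le
    · field_simp
      ring

/-- The divided difference over `[β i, β j]` of the positive part function `(· - t)⁺`, where
`t` lies between the points with index `k` and `k + 1`. -/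
noncomputable def kinkKernel (β t : ℕ → ℝ) (k i j : ℕ) : ℝ :=
  if j ≤ k then 0 else if k < i then 1 else (β j - t k) / (β j - β i)

section Decomposition

variable {β d g t : ℕ → ℝ}

theorem kinkKernel_mem_Icc (hβ : Monotone β) (ht1 : ∀ k, β k ≤ t k) (ht2 : ∀ k, t k ≤ β (k + 1))
    (k i j : ℕ) : kinkKernel β t k i j ∈ Set.Icc (0 : ℝ) 1 := by
  unfold kinkKernel
  split_ifs with h1 h2
  · simp
  · simp
  · have e1 : t k ≤ β j := (ht2 k).trans (hβ (by omega))
    have e2 : β i ≤ t k := (hβ (by omega)).trans (ht1 k)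
    exact ⟨div_nonneg (by linarith) (by linarith), div_le_one_of_le₀ (by linarith) (by linarith)⟩

theorem increment_eq_sum_kinks
    (hg : ∀ k, g (k + 1) - g k = d k * (t k - β k) + d (k + 1) * (β (k + 1) - t k))
    (i p : ℕ) : g (i + p) - g i = d i * (β (i + p) - β i) +
      ∑ k ∈ Finset.range p, (d (i + k + 1) - d (i + k)) * (β (i + p) - t (i + k)) := by
  induction p with
  | zero => simp
  | succ p ih =>
    have htel : ∑ k ∈ Finset.range p, (d (i + k + 1) - d (i + k)) = d (i + p) - d i := by
      simpa [add_assoc] using Finset.sum_range_sub (fun k => d (i + k)) p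
    have hsum : ∑ k ∈ Finset.range p,
          (d (i + k + 1) - d (i + k)) * (β (i + (p + 1)) - t (i + k)) =
        ∑ k ∈ Finset.range p, (d (i + k + 1) - d (i + k)) * (β (i + p) - t (i + k)) +
          (d (i + p) - d i) * (β (i + (p + 1)) - β (i + p)) := by
      rw [← htel, Finset.sum_mul, ← Finset.sum_add_distrib]
      exact Finset.sum_congr rfl fun k _ => by ring
    have := hg (i + p)
    rw [Finset.sum_range_succ, hsum]
    simp only [← add_assoc] at *
    linear_combination this + ih

/-- Kinks left of `β i` count fully and telescope to `d i`, those right of `β j` vanish, and those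
between supply the rest of the increment. -/
theorem sum_kinkKernel_eq_dividedDifference
    (hg : ∀ k, g (k + 1) - g k = d k * (t k - β k) + d (k + 1) * (β (k + 1) - t k))
    (hd0 : d 0 = 0) {i j N : ℕ} (hij : i ≤ j) (hjN : j ≤ N) :
    ∑ k ∈ Finset.range N, (d (k + 1) - d k) * kinkKernel β t k i j =
      if β i = β j then d i else (g j - g i) / (β j - β i) := by
  obtain ⟨p, rfl⟩ := Nat.exists_eq_add_of_le hij
  obtain ⟨q, rfl⟩ := Nat.exists_eq_add_of_le hjN
  rw [Finset.sum_range_add, Finset.sum_range_add]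
  have s1 : ∑ k ∈ Finset.range i, (d (k + 1) - d k) * kinkKernel β t k i (i + p) = d i := by
    have h : ∑ k ∈ Finset.range i, (d (k + 1) - d k) = d i := by
      rw [Finset.sum_range_sub, hd0, sub_zero]
    refine (Finset.sum_congr rfl fun k hk => ?_).trans h
    have hk' := Finset.mem_range.1 hk
    rw [kinkKernel, if_neg (by omega), if_pos hk', mul_one]
  have s3 : ∑ k ∈ Finset.range q, (d (i + p + k + 1) - d (i + p + k)) *
      kinkKernel β t (i + p + k) i (i + p) = 0 :=
    Finset.sum_eq_zero fun k _ => by rw [kinkKernel, if_pos (by omega), mul_zero]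
  have s2 : ∑ k ∈ Finset.range p, (d (i + k + 1) - d (i + k)) * kinkKernel β t (i + k) i (i + p) =
      (∑ k ∈ Finset.range p, (d (i + k + 1) - d (i + k)) * (β (i + p) - t (i + k))) /
        (β (i + p) - β i) := by
    rw [Finset.sum_div]
    refine Finset.sum_congr rfl fun k hk => ?_
    have hk' := Finset.mem_range.1 hk
    rw [kinkKernel, if_neg (by omega), if_neg (by omega), mul_div_assoc]
  rw [s1, s2, s3, add_zero]
  split_ifs with h
  -- At coincident points the middle sum is a division by zero, hence 0, which leaves the
  -- derivative.
  · rw [h, sub_self, div_zero, add_zero]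
  · have h' : β (i + p) - β i ≠ 0 := sub_ne_zero.2 (Ne.symm h)
    rw [increment_eq_sum_kinks hg i p, add_div, mul_div_cancel_right₀ _ h']

end Decomposition

/-! ### The constant, and assembly -/

theorem sum_range_sub_mul_succ (d : ℕ → ℝ) (N : ℕ) :
    ∑ k ∈ Finset.range N, (d (k + 1) - d k) * (k + 1 : ℝ) =
      ∑ j ∈ Finset.range (N + 1), (d N - d j) := by
  induction N with
  | zero => simp
  | succ N ih =>
    rw [Finset.sum_range_succ, ih, Finset.sum_range_succ _ (N + 1)]
    simp only [Finset.sum_sub_distrib, Finset.sum_const, Finset.card_range, nsmul_eq_mul]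
    push_cast
    ring

/-- For `m = k + 1`, the relation `φ⁻² + φ⁻¹ = 1` makes the difference of the two sides `φ⁻² m (m -
1)`; equality at `m = 1` is what selects the golden ratio. -/
theorem natCast_succ_le_of_goldenRatio (k : ℕ) :
    ((k + 1 : ℕ) : ℝ) ≤ (1 + Real.goldenRatio⁻¹ * (k + 1)) *
      (1 + Real.goldenRatio⁻¹ * (k + 1) - 1) := by
  have hp : 0 < Real.goldenRatio⁻¹ := inv_pos.2 Real.goldenRatio_pos
  have h1 : Real.goldenRatio⁻¹ ^ 2 + Real.goldenRatio⁻¹ = 1 := by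
    rw [Real.inv_goldenRatio, neg_sq, Real.goldenConj_sq]
    ring
  have hk : (0 : ℝ) ≤ k := k.cast_nonneg
  have h2 : 0 ≤ Real.goldenRatio⁻¹ ^ 2 * ((k + 1) * k : ℝ) := by positivity
  push_cast
  linear_combination h2 - (k + 1 : ℝ) * h1

theorem schurNorm_le {n : ℕ} {L : Matrix (Fin n) (Fin n) ℂ} {c : ℝ}
    (hc : 0 ≤ c) (h : ∀ A, ‖L ⊙ A‖ ≤ c * ‖A‖) : schurNorm L ≤ c :=
  ciSup_le fun A => div_le_of_le_mul₀ (norm_nonneg _) hc (h A)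

theorem ConcaveOn.derivWithin_bounds {S : Set ℝ} {h : ℝ → ℝ} (hconc : ConcaveOn ℝ S h) {x y : ℝ}
    (hx : x ∈ S) (hy : y ∈ S) (hxy : x ≤ y) (hdx : DifferentiableWithinAt ℝ h S x)
    (hdy : DifferentiableWithinAt ℝ h S y) :
    derivWithin h S y * (y - x) ≤ h y - h x ∧ h y - h x ≤ derivWithin h S x * (y - x) ∧
      derivWithin h S y ≤ derivWithin h S x := by
  rcases hxy.eq_or_lt with rfl | hlt
  · simp
  · have h1 := hconc.derivWithin_le_slope hx hy hlt hdy
    have h2 := hconc.slope_le_derivWithin hx hy hlt hdx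
    refine ⟨?_, ?_, h1.trans h2⟩
    · rwa [slope_def_field, le_div_iff₀ (sub_pos.2 hlt)] at h1
    · rwa [slope_def_field, div_le_iff₀ (sub_pos.2 hlt)] at h2

theorem mainTheorem11 {n : ℕ} (hn : 0 < n)
    (B : Matrix (Fin n) (Fin n) ℂ) (hB : B.IsHermitian)
    (b : Fin n → ℝ) (hb : IsEigenvalueList B b) (hmono : Monotone b)
    (b₁ bₙ : ℝ) (hb₁ : b₁ = b ⟨0, hn⟩) (hbₙ : bₙ = b ⟨n - 1, Nat.sub_lt hn Nat.one_pos⟩)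
    (h : ℝ → ℝ) (hconc : ConcaveOn ℝ (Set.Icc b₁ bₙ) h)
    (hdiff : ∀ j, DifferentiableWithinAt ℝ h (Set.Icc b₁ bₙ) (b j))
    (h_left : derivWithin h (Set.Icc b₁ bₙ) b₁ = 0)
    (h_right : derivWithin h (Set.Icc b₁ bₙ) bₙ = -1) :
    schurNorm (loewnerMatrix h (Set.Icc b₁ bₙ) b) ≤
      1 + Real.goldenRatio⁻¹ * ∑ j : Fin n, (1 + derivWithin h (Set.Icc b₁ bₙ) (b j)) := by
  obtain ⟨N, rfl⟩ : ∃ N, n = N + 1 := ⟨n - 1, by omega⟩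
  set S := Set.Icc b₁ bₙ with hS
  -- Clamping at `N` makes the sequences constant afterwards, so the gap conditions hold for every
  -- `k`.
  let ι : ℕ → Fin (N + 1) := fun i => ⟨min i N, by omega⟩
  have hι : ∀ i : Fin (N + 1), ι i = i := fun i => Fin.ext (by simp [ι]; omega)
  let β : ℕ → ℝ := fun i => b (ι i)
  let d : ℕ → ℝ := fun i => -derivWithin h S (β i)
  let g : ℕ → ℝ := fun i => -h (β i)
  have hβ : Monotone β := fun i j hij => hmono (Fin.mk_le_mk.2 (min_le_min_right _ hij))
  have hβi : ∀ i : Fin (N + 1), β i = b i := fun i => congrArg b (hι i)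
  have hmem : ∀ j, b j ∈ S := fun j => by
    rw [hS, hb₁, hbₙ]
    exact ⟨hmono (Fin.mk_le_mk.2 (Nat.zero_le _)), hmono (Fin.le_def.2 (by simp; omega))⟩
  have hd0 : d 0 = 0 := by
    have : β 0 = b₁ := by rw [hb₁]; exact hβi ⟨0, hn⟩
    simp only [d, this, h_left, neg_zero]
  have hdN : d N = 1 := by
    have : β N = bₙ := by rw [hbₙ]; exact hβi ⟨N, by omega⟩
    simp only [d, this, h_right, neg_neg]
  have hbd := fun k => hconc.derivWithin_bounds (hmem (ι k)) (hmem (ι (k + 1)))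
    (hβ k.le_succ) (hdiff _) (hdiff _)
  have hw : ∀ k, 0 ≤ d (k + 1) - d k := fun k => by
    have := (hbd k).2.2
    simp only [d, β]
    linarith
  have hkink : ∀ k, ∃ t, β k ≤ t ∧ t ≤ β (k + 1) ∧
      g (k + 1) - g k = d k * (t - β k) + d (k + 1) * (β (k + 1) - t) := fun k =>
    exists_kink (hβ k.le_succ) (by simp only [d, g, β]; linarith [(hbd k).2.1])
      (by simp only [d, g, β]; linarith [(hbd k).1]) (sub_nonneg.1 (hw k))
  choose t ht1 ht2 hg using hkink
  -- `kinkKernel` is a divided difference only for ordered indices; `min` and `max` symmetrize it.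
  let L : ℕ → Matrix (Fin (N + 1)) (Fin (N + 1)) ℂ := fun k => Matrix.of fun i j =>
    ((kinkKernel β t k (min i j : Fin (N + 1)) (max i j : Fin (N + 1)) : ℝ) : ℂ)
  have hentry : ∀ i j : Fin (N + 1), i ≤ j →
      (∑ k ∈ Finset.range N, (d (k + 1) - d k) * kinkKernel β t k i j) =
        -(if b i = b j then derivWithin h S (b i) else (h (b i) - h (b j)) / (b i - b j)) := by
    intro i j hij
    rw [sum_kinkKernel_eq_dividedDifference hg hd0 hij (by omega)]
    simp only [d, g, hβi]
    split_ifs with hc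
    · rfl
    · have h1 : b i - b j ≠ 0 := sub_ne_zero.2 hc
      have h2 : b j - b i ≠ 0 := sub_ne_zero.2 (Ne.symm hc)
      rw [← neg_sub (b i) (b j)]
      field_simp
      ring
  have hK : loewnerMatrix h S b = -∑ k ∈ Finset.range N, ((d (k + 1) - d k : ℝ) : ℂ) • L k := by
    ext i j
    rw [Matrix.neg_apply, Matrix.sum_apply]
    simp only [loewnerMatrix, L, Matrix.of_apply, Matrix.smul_apply, smul_eq_mul]
    rw [eq_neg_iff_add_eq_zero]
    norm_cast
    rcases le_total i j with hij | hij
    · rw [min_eq_left hij, max_eq_right hij, hentry i j hij, add_neg_cancel]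
    · rw [min_eq_right hij, max_eq_left hij, hentry j i hij, add_neg_eq_zero]
      rcases eq_or_ne (b i) (b j) with hc | hc
      · rw [if_pos hc, if_pos hc.symm, hc]
      · rw [if_neg hc, if_neg hc.symm, ← neg_sub (h (b j)), ← neg_sub (b j), neg_div_neg_eq]
  have hLk : ∀ k A, ‖L k ⊙ A‖ ≤ (1 + Real.goldenRatio⁻¹ * (k + 1)) * ‖A‖ := by
    intro k A
    have hp : 0 < Real.goldenRatio⁻¹ := inv_pos.2 Real.goldenRatio_pos
    have hcard : (Finset.univ.filter fun i : Fin (N + 1) => (i : ℕ) ≤ k).card ≤ k + 1 := by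
      rw [← Finset.card_range (k + 1)]
      exact Finset.card_le_card_of_injOn Fin.val (fun i hi => by simpa [Nat.lt_succ_iff] using hi)
        Fin.val_injective.injOn
    refine norm_hadamard_le_of_blocks (L k) A (Finset.univ.filter fun i => (i : ℕ) ≤ k)
      (lt_add_of_pos_right _ (by positivity))
      ((Nat.cast_le.2 hcard).trans (natCast_succ_le_of_goldenRatio k)) ?_ ?_ ?_
    · intro i hi j hj
      simp only [Finset.mem_filter, Finset.mem_univ, true_and] at hi hj
      have : ((max i j : Fin (N + 1)) : ℕ) ≤ k := by
        rcases le_total i j with hij | hij <;> simp [hij, hi, hj]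
      simp only [L, kinkKernel, Matrix.of_apply, if_pos this, Complex.ofReal_zero]
    · intro i hi j hj
      simp only [Finset.mem_filter, Finset.mem_univ, true_and, not_le] at hi hj
      have h1 : k < ((min i j : Fin (N + 1)) : ℕ) := by
        rcases le_total i j with hij | hij <;> simp [hij, hi, hj]
      have h2 : ¬ ((max i j : Fin (N + 1)) : ℕ) ≤ k := by
        rcases le_total i j with hij | hij <;> simp [hij, hi, hj]
      simp only [L, kinkKernel, Matrix.of_apply, if_neg h2, if_pos h1, Complex.ofReal_one]
    · intro i j
      have hI := kinkKernel_mem_Icc hβ ht1 ht2 k (min i j : Fin (N + 1)) (max i j : Fin (N + 1))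
      simp only [L, Matrix.of_apply, Complex.norm_real]
      rw [Real.norm_of_nonneg hI.1]
      exact hI.2
  have hbound : 1 + Real.goldenRatio⁻¹ * ∑ j : Fin (N + 1), (1 + derivWithin h S (b j)) =
      ∑ k ∈ Finset.range N, (d (k + 1) - d k) * (1 + Real.goldenRatio⁻¹ * (k + 1)) := by
    have h1 : ∑ j : Fin (N + 1), (1 + derivWithin h S (b j)) =
        ∑ j ∈ Finset.range (N + 1), (d N - d j) := by
      rw [Finset.sum_range]
      exact Finset.sum_congr rfl fun j _ => by rw [hdN]; simp only [d, hβi, sub_neg_eq_add]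
    have h2 : ∑ k ∈ Finset.range N, (d (k + 1) - d k) = 1 := by
      rw [Finset.sum_range_sub, hdN, hd0, sub_zero]
    rw [h1, ← sum_range_sub_mul_succ, Finset.mul_sum]
    nth_rw 1 [← h2]
    rw [← Finset.sum_add_distrib]
    exact Finset.sum_congr rfl fun k _ => by ring
  rw [hbound]
  refine schurNorm_le (Finset.sum_nonneg fun k _ => mul_nonneg (hw k) ?_) fun A => ?_
  · have : 0 < Real.goldenRatio⁻¹ := inv_pos.2 Real.goldenRatio_pos
    positivity
  · have hsum : (loewnerMatrix h S b) ⊙ A =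
        -∑ k ∈ Finset.range N, ((d (k + 1) - d k : ℝ) : ℂ) • (L k ⊙ A) := by
      rw [hK]
      ext i j
      simp only [Matrix.hadamard_apply, Matrix.neg_apply, Matrix.sum_apply, Matrix.smul_apply,
        smul_eq_mul, neg_mul, Finset.sum_mul, mul_assoc]
    rw [hsum, norm_neg, Finset.sum_mul]
    refine norm_sum_le_of_le _ fun k _ => ?_
    rw [norm_smul, Complex.norm_real, Real.norm_of_nonneg (hw k), mul_assoc]
    exact mul_le_mul_of_nonneg_left (hLk k A) (hw k)
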